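/- Let $P\subset\mathbb{R}^n$ be an $n$-dimensional convex polytope, and for $0\le i\le n$ let $f_i$ be the number of its $i$-dimensional faces (so $f_n=1$). Its $h$-polynomial is $h(P)(t)=\sum_{i=0}^n f_i\,(t-1)^i$. If $$h(P)(t)=\sum_{i=0}^{\lfloor n/2\rfloor}\gamma_i\,t^i(1+t)^{n-2i}$$ for some integers $\gamma_i$, then these integers are unique, and $(\gamma_0,\dots,\gamma_{\lfloor n/2\rfloor})$ is called the $\gamma$-vector of $P$; it exists for every simple $P$, that is, when every vertex of $P$ lies in exactly $n$ facets. Two polytopes are combinatorially equivalent if their posets of faces are isomorphic. Let $P\subset\mathbb{R}^n$ be a simple $n$-dimensional polytope and $G$ a nonempty face of $P$. A polytope $Q$ is obtained from $P$ by shaving $G$ if there are a linear function $l$ on $\mathbb{R}^n$, a real number $c$ and an $\varepsilon>0$ such that $l\le c$ on $P$, $G=\{x\in P: l(x)=c\}$, every vertex $v$ of $P$ that is not in $G$ satisfies $l(v)<c-\varepsilon$, and $Q=\{x\in P: l(x)\le c-\varepsilon\}$. Let $\mathcal{P}^{cube}$ be the class of polytopes that can be obtained, up to combinatorial equivalence,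 from a cube by successively shaving faces of codimension $2$; that is, for each $n\geq 0$, the smallest class of $n$-dimensional polytopes in $\mathbb{R}^n$ that contains the cube $[0,1]^n$, is closed under combinatorial equivalence, and contains with each $P$ every polytope obtained from $P$ by shaving a face of dimension $n-2$. **Proposition.** Every $P\in\mathcal{P}^{cube}$ has a (unique) $\gamma$-vector, and all its entries are nonnegative: $\gamma_i(P)\ge 0$ for $0\le i\le\lfloor n/2\rfloor$. -/

import Mathlib

open Polynomial

noncomputable section

namespace ShavedCubes

variable {n : ℕ}

/-- The dimension of (the affine hull of) a set; it is only used for nonempty sets. -/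
def dim (P : Set (Fin n → ℝ)) : ℕ :=
  Module.finrank ℝ (vectorSpan ℝ P)

/-- `P` is an `n`-dimensional convex polytope in `ℝⁿ`. -/
structure IsPolytope (P : Set (Fin n → ℝ)) : Prop where
  /-- `P` is the convex hull of finitely many points -/
  eq_convexHull : ∃ s : Finset (Fin n → ℝ), P = convexHull ℝ (s : Set (Fin n → ℝ))
  nonempty : P.Nonempty
  dim_eq : dim P = n

/-- `F` is a nonempty face of `P`: the set of all maximizers on `P` of some linear function.
The polytope is a face of itself (take the zero function). -/
def IsFace (P F : Set (Fin n → ℝ)) : Prop :=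
  F.Nonempty ∧ IsExposed ℝ P F

/-- A facet of an `n`-dimensional polytope: a face of dimension `n - 1`. -/
def IsFacet (P F : Set (Fin n → ℝ)) : Prop :=
  IsFace P F ∧ dim F + 1 = n

/-- `P` is a simple `n`-dimensional polytope: each vertex lies in exactly `n` facets. -/
structure IsSimplePolytope (P : Set (Fin n → ℝ)) : Prop extends IsPolytope P where
  simple : ∀ v ∈ P.extremePoints ℝ, {F | IsFacet P F ∧ v ∈ F}.ncard = n

/-- Combinatorial equivalence: the posets of nonempty faces, ordered by inclusion, are
isomorphic. -/
def CombEquiv {m : ℕ} (P : Set (Fin n → ℝ)) (Q : Set (Fin m → ℝ)) : Prop :=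
  Nonempty ({F // IsFace P F} ≃o {F // IsFace Q F})

/-- `Q` is obtained from the simple `n`-dimensional polytope `P` by shaving its face `G`:
`l ≤ c` on `P`, with equality exactly on `G`, and `Q` is cut out of `P` by `l ≤ c - ε`, where
`ε > 0` is so small that the vertices of `P` outside `G` satisfy `l < c - ε`.
(After a translation that makes `0` an interior point of `P`, one may rescale to `c = 1`.) -/
structure IsShaving (P G Q : Set (Fin n → ℝ)) : Prop where
  simple : IsSimplePolytope P
  isFace : IsFace P G
  exists_cut : ∃ (l : (Fin n → ℝ) →ₗ[ℝ] ℝ) (c ε : ℝ),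
    0 < ε ∧
    (∀ x ∈ P, l x ≤ c) ∧
    {x ∈ P | l x = c} = G ∧
    (∀ v ∈ P.extremePoints ℝ, v ∉ G → l v < c - ε) ∧
    Q = {x ∈ P | l x ≤ c - ε}

/-- The standard cube `[0,1]ⁿ`. -/
def cube (n : ℕ) : Set (Fin n → ℝ) := Set.Icc 0 1

/-- The class of those `n`-dimensional polytopes that, as combinatorial polytopes, can be obtained
from the `n`-cube by successively shaving faces of codimension 2. -/
inductive IsShavedCube : Set (Fin n → ℝ) → Prop
  | cube : IsShavedCube (cube n)
  | shave {P G Q : Set (Fin n → ℝ)} :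
      IsShavedCube P → dim G + 2 = n → IsShaving P G Q → IsShavedCube Q
  | equiv {P Q : Set (Fin n → ℝ)} :
      IsShavedCube P → IsPolytope Q → CombEquiv P Q → IsShavedCube Q

/-- The number `f_i` of `i`-dimensional faces of `P`. -/
def fVector (P : Set (Fin n → ℝ)) (i : ℕ) : ℕ :=
  {F | IsFace P F ∧ dim F = i}.ncard

/-- The `h`-polynomial `h(t) = f₀ + f₁ (t - 1) + ⋯ + fₙ (t - 1)ⁿ`. -/
def hPoly (P : Set (Fin n → ℝ)) : ℤ[X] :=
  ∑ i ∈ Finset.range (n + 1), C (fVector P i : ℤ) * (X - 1) ^ i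

/-- `γ = (γ₀, …, γ_{⌊n/2⌋})` is a `γ`-vector of the `n`-dimensional polytope `P`:
`h(P)(t) = ∑ i, γ_i tⁱ (1 + t)ⁿ⁻²ⁱ`. -/
def IsGammaVector (P : Set (Fin n → ℝ)) (γ : Fin (n / 2 + 1) → ℤ) : Prop :=
  hPoly P = ∑ i : Fin (n / 2 + 1), C (γ i) * X ^ (i : ℕ) * (1 + X) ^ (n - 2 * (i : ℕ))

end ShavedCubes

end

/-! The faces of `P`, with reversed inclusion, form a simplicial complex `K`, and `h(P)` is the sum
of `(t-1)^(n-|T|)` over `T ∈ K`. Shaving the codimension-2 face dual to an edge `e` replaces `K` by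
its stellar subdivision at `e`, and a count gives `h' = h + t · h(lk e)`. To iterate,
`γ`-nonnegativity of `h` alone is too weak, since the link of `e` enters; the invariant
(`IsGammaComplex`) is that every link has `γ`-nonnegative `h`-polynomial.

It is preserved (`IsGammaComplex.stellar`): for an old face `S` the polynomial stays the same, or
gains `t · h(lk(S ∪ e))` when `S` is disjoint from `e` and `S ∪ e ∈ K`; for a face `S` coned to the
new vertex it is `h(lk(S ∪ e))` or `(1+t) · h(lk(S ∪ e))`. The cube starts the induction: its dual
is the boundary of the cross-polytope, whose links have `h = (1+t)^(n-|S|)`.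

The geometric input is `IsDualComplex.of_isShaving`: the faces of the cut polytope are traces `l ≤
b` or `l = b` of faces of `P`, indexed by points in their relative interiors. Uniqueness of the
`γ`-vector is triangularity of the family `tⁱ(1+t)^(n-2i)`. -/

namespace ShavedCubes

/-! ### Polynomials with nonnegative `γ`-coefficients. -/

/-- The `γ`-nonnegative polynomials of degree `d`: the nonnegative integer combinations of the
polynomials `tⁱ (1 + t)ʲ` with `2 i + j = d`. -/
noncomputable def gammaCone (d : ℕ) : AddSubmonoid ℤ[X] :=
  AddSubmonoid.closure {p | ∃ i j : ℕ, 2 * i + j = d ∧ p = X ^ i * (1 + X) ^ j}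

theorem one_add_X_pow_mem_gammaCone (d : ℕ) : (1 + X : ℤ[X]) ^ d ∈ gammaCone d :=
  AddSubmonoid.subset_closure ⟨0, d, by simp, by simp⟩

theorem one_add_X_mul_mem_gammaCone {d : ℕ} {p : ℤ[X]} (hp : p ∈ gammaCone d) :
    (1 + X) * p ∈ gammaCone (d + 1) := by
  induction hp using AddSubmonoid.closure_induction with
  | mem p hp =>
    obtain ⟨i, j, h, rfl⟩ := hp
    exact AddSubmonoid.subset_closure ⟨i, j + 1, by omega, by ring⟩
  | zero => simp
  | add p q _ _ hp hq => rw [mul_add]; exact add_mem hp hq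

theorem X_mul_mem_gammaCone {d : ℕ} {p : ℤ[X]} (hp : p ∈ gammaCone d) :
    X * p ∈ gammaCone (d + 2) := by
  induction hp using AddSubmonoid.closure_induction with
  | mem p hp =>
    obtain ⟨i, j, h, rfl⟩ := hp
    exact AddSubmonoid.subset_closure ⟨i + 1, j, by omega, by ring⟩
  | zero => simp
  | add p q _ _ hp hq => rw [mul_add]; exact add_mem hp hq

theorem exists_nonneg_coeff_of_mem_gammaCone {d : ℕ} {p : ℤ[X]} (hp : p ∈ gammaCone d) :
    ∃ γ : Fin (d / 2 + 1) → ℤ, (∀ i, 0 ≤ γ i) ∧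
      p = ∑ i : Fin (d / 2 + 1), C (γ i) * X ^ (i : ℕ) * (1 + X) ^ (d - 2 * (i : ℕ)) := by
  induction hp using AddSubmonoid.closure_induction with
  | mem p hp =>
    obtain ⟨i, j, h, rfl⟩ := hp
    refine ⟨Pi.single ⟨i, by omega⟩ 1, fun k => ?_, ?_⟩
    · by_cases hk : k = ⟨i, by omega⟩
      · subst hk; simp
      · simp [hk]
    · rw [Finset.sum_eq_single ⟨i, by omega⟩]
      · simp [← h]
      · intro k _ hk
        simp [hk]
      · simp
  | zero => exact ⟨0, by simp, by simp⟩
  | add p q _ _ hp hq =>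
    obtain ⟨γ, hγ, rfl⟩ := hp
    obtain ⟨δ, hδ, rfl⟩ := hq
    refine ⟨γ + δ, fun i => add_nonneg (hγ i) (hδ i), ?_⟩
    rw [← Finset.sum_add_distrib]
    exact Finset.sum_congr rfl fun i _ => by simp [add_mul]

/-- The `i`-th basis polynomial is `tⁱ` plus higher terms, so the system for the coefficients is
unitriangular and is solved by induction on the exponent. -/
theorem gamma_expansion_injective {d : ℕ} {γ δ : Fin (d / 2 + 1) → ℤ}
    (h : ∑ i : Fin (d / 2 + 1), C (γ i) * X ^ (i : ℕ) * (1 + X : ℤ[X]) ^ (d - 2 * (i : ℕ)) =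
      ∑ i : Fin (d / 2 + 1), C (δ i) * X ^ (i : ℕ) * (1 + X) ^ (d - 2 * (i : ℕ))) :
    γ = δ := by
  have h0 : ∑ i : Fin (d / 2 + 1),
      X ^ (i : ℕ) * (C (γ i - δ i) * (1 + X : ℤ[X]) ^ (d - 2 * (i : ℕ))) = 0 := by
    rw [← sub_eq_zero, ← Finset.sum_sub_distrib] at h
    rw [← h]
    exact Finset.sum_congr rfl fun i _ => by rw [C_sub]; ring
  have key : ∀ m : ℕ, ∀ hm : m < d / 2 + 1, γ ⟨m, hm⟩ - δ ⟨m, hm⟩ = 0 := by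
    intro m
    induction m using Nat.strong_induction_on with
    | _ m ih =>
      intro hm
      have hc := congrArg (fun p => coeff p m) h0
      simp only [finsetSum_coeff, coeff_zero, coeff_X_pow_mul'] at hc
      rw [Finset.sum_eq_single ⟨m, hm⟩] at hc
      · simpa [mul_coeff_zero, coeff_zero_eq_eval_zero] using hc
      · intro i _ hi
        have hne : (i : ℕ) ≠ m := fun h => hi (Fin.ext h)
        split_ifs with hle
        · have := ih i (by omega) i.2
          simp [this]
        · rfl
      · simp
  funext i
  exact sub_eq_zero.1 (key i i.2)

/-! ### Stellar subdivision at an edge and the `h`-polynomials of links. -/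

variable {ι : Type*}

theorem map_some_subset_insertNone {S T : Finset ι} :
    S.map Function.Embedding.some ⊆ Finset.insertNone T ↔ S ⊆ T := by
  constructor
  · intro h i hi
    simpa using h (Finset.mem_map_of_mem Function.Embedding.some hi)
  · intro h o ho
    obtain ⟨i, hi, rfl⟩ := Finset.mem_map.1 ho
    simpa using h hi

theorem not_insertNone_subset_map_some {S T : Finset ι} :
    ¬ Finset.insertNone S ⊆ T.map Function.Embedding.some := by
  intro h
  simpa using h (Finset.none_mem_insertNone (s := S))

theorem insertNone_subset_insertNone {S T : Finset ι} :
    Finset.insertNone S ⊆ Finset.insertNone T ↔ S ⊆ T :=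
  Finset.insertNone.le_iff_le

section Complex

variable [DecidableEq ι]

/-- The `h`-polynomial of the link of `S` in the family `K`: the sum of the monomials
`(t - 1)ⁿ⁻|T|` over the members `T ⊇ S` of `K`. -/
noncomputable def linkH (n : ℕ) (K : Finset (Finset ι)) (S : Finset ι) : ℤ[X] :=
  ∑ T ∈ K with S ⊆ T, (X - 1) ^ (n - T.card)

/-- A pure simplicial complex with facets of size `n` all of whose links have `γ`-nonnegative
`h`-polynomials. -/
structure IsGammaComplex (n : ℕ) (K : Finset (Finset ι)) : Prop where
  down : ∀ S ∈ K, ∀ T ⊆ S, T ∈ K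
  empty_mem : ∅ ∈ K
  pure : ∀ S ∈ K, ∃ T ∈ K, S ⊆ T ∧ T.card = n
  linkH_mem : ∀ S ∈ K, linkH n K S ∈ gammaCone (n - S.card)

theorem IsGammaComplex.card_le {n : ℕ} {K : Finset (Finset ι)} (hK : IsGammaComplex n K)
    {S : Finset ι} (hS : S ∈ K) : S.card ≤ n := by
  obtain ⟨T, -, hST, rfl⟩ := hK.pure S hS
  exact Finset.card_le_card hST

/-- The members of `K` that do not contain `e`. -/
def deletion (K : Finset (Finset ι)) (e : Finset ι) : Finset (Finset ι) :=
  {S ∈ K | ¬ e ⊆ S}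

/-- The members of the boundary of the star of `e` in `K`. -/
def starBoundary (K : Finset (Finset ι)) (e : Finset ι) : Finset (Finset ι) :=
  {S ∈ K | ¬ e ⊆ S ∧ S ∪ e ∈ K}

/-- The stellar subdivision of `K` at `e`, with new vertex `none`. -/
def stellar (K : Finset (Finset ι)) (e : Finset ι) : Finset (Finset (Option ι)) :=
  (deletion K e).image (fun S => S.map Function.Embedding.some) ∪
    (starBoundary K e).image fun S => Finset.insertNone S

theorem mem_stellar {K : Finset (Finset ι)} {e : Finset ι} {U : Finset (Option ι)} :
    U ∈ stellar K e ↔ (∃ S ∈ deletion K e, S.map Function.Embedding.some = U) ∨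
      ∃ S ∈ starBoundary K e, Finset.insertNone S = U := by
  simp [stellar]

theorem sum_stellar (n : ℕ) (K : Finset (Finset ι)) (e : Finset ι) (U : Finset (Option ι)) :
    linkH n (stellar K e) U =
      ∑ T ∈ deletion K e with U ⊆ T.map Function.Embedding.some, (X - 1) ^ (n - T.card) +
      ∑ T ∈ starBoundary K e with U ⊆ Finset.insertNone T, (X - 1) ^ (n - (T.card + 1)) := by
  rw [linkH, stellar, Finset.filter_union, Finset.sum_union, Finset.filter_image,
    Finset.filter_image, Finset.sum_image, Finset.sum_image]
  · simp
  · intro S _ T _ h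
    exact Finset.insertNone.injective h
  · intro S _ T _ h
    exact Finset.map_injective _ h
  · rw [Finset.disjoint_left]
    intro V hV hV'
    simp only [Finset.mem_filter, Finset.mem_image] at hV hV'
    obtain ⟨⟨S, -, rfl⟩, -⟩ := hV
    obtain ⟨⟨T, -, h⟩, -⟩ := hV'
    exact not_insertNone_subset_map_some h.le

/-- Adding `e` maps the boundary faces that miss exactly `J` from `e` bijectively to the faces
containing `S ∪ e`, with inverse removal of `J`. Sizes grow by `|J|`, whence the factor; `J` is
nonempty, so `|J| - 1` is not truncated. -/
theorem sum_starBoundary_fiber {n : ℕ} {K : Finset (Finset ι)} (hK : IsGammaComplex n K)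
    {e S J : Finset ι} (hJ : J ⊆ e \ S) (hne : J.Nonempty) :
    ∑ T ∈ starBoundary K e with S ⊆ T ∧ e \ T = J, (X - 1 : ℤ[X]) ^ (n - (T.card + 1)) =
      (X - 1) ^ (J.card - 1) * linkH n K (S ∪ e) := by
  rw [linkH, Finset.mul_sum]
  have hJe : J ⊆ e := hJ.trans Finset.sdiff_subset
  have hJS : Disjoint S J := Finset.disjoint_of_subset_right hJ Finset.disjoint_sdiff
  have hpos := hne.card_pos
  refine Finset.sum_bij' (fun T _ => T ∪ e) (fun U _ => U \ J) ?_ ?_ ?_ ?_ ?_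
  · intro T hT
    simp only [starBoundary, Finset.mem_filter] at hT ⊢
    exact ⟨hT.1.2.2, Finset.union_subset_union_left hT.2.1⟩
  · intro U hU
    simp only [starBoundary, Finset.mem_filter] at hU ⊢
    obtain ⟨hU, hSU⟩ := hU
    have heU : e ⊆ U := Finset.subset_union_right.trans hSU
    have h1 : U \ J ∪ e = U := by grind
    refine ⟨⟨hK.down U hU _ Finset.sdiff_subset, ?_, by rwa [h1]⟩, ?_, ?_⟩
    · obtain ⟨j, hj⟩ := hne
      intro h
      exact (Finset.mem_sdiff.1 (h (hJe hj))).2 hj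
    · rw [Finset.subset_sdiff]
      exact ⟨Finset.subset_union_left.trans hSU, hJS⟩
    · grind
  · intro T hT
    simp only [Finset.mem_filter] at hT
    grind
  · intro U hU
    simp only [Finset.mem_filter] at hU
    grind
  · intro T hT
    simp only [starBoundary, Finset.mem_filter] at hT
    rw [← pow_add]
    congr 1
    have h1 : (T ∪ e).card = T.card + J.card := by
      rw [← Finset.union_sdiff_self_eq_union, Finset.card_union_of_disjoint
        Finset.disjoint_sdiff, hT.2.2]
    have h2 := hK.card_le hT.1.2.2
    omega

theorem sum_starBoundary {n : ℕ} {K : Finset (Finset ι)} (hK : IsGammaComplex n K)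
    (e S : Finset ι) :
    ∑ T ∈ starBoundary K e with S ⊆ T, (X - 1 : ℤ[X]) ^ (n - (T.card + 1)) =
      (∑ J ∈ (e \ S).powerset.erase ∅, (X - 1) ^ (J.card - 1)) * linkH n K (S ∪ e) := by
  rw [Finset.sum_mul, ← Finset.sum_fiberwise_of_maps_to
    (g := fun T => e \ T) (t := (e \ S).powerset.erase ∅)]
  · refine Finset.sum_congr rfl fun J hJ => ?_
    rw [Finset.mem_erase, Finset.mem_powerset] at hJ
    rw [← sum_starBoundary_fiber hK hJ.2 (Finset.nonempty_iff_ne_empty.2 hJ.1),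
      Finset.filter_filter]
  · intro T hT
    simp only [starBoundary, Finset.mem_filter] at hT
    rw [Finset.mem_erase, Finset.mem_powerset, Ne, Finset.sdiff_eq_empty_iff_subset]
    exact ⟨hT.1.2.1, Finset.sdiff_subset_sdiff le_rfl hT.2⟩

theorem sum_starBoundary_of_card_one {n : ℕ} {K : Finset (Finset ι)} (hK : IsGammaComplex n K)
    {e S : Finset ι} (h : (e \ S).card = 1) :
    ∑ T ∈ starBoundary K e with S ⊆ T, (X - 1 : ℤ[X]) ^ (n - (T.card + 1)) =
      linkH n K (S ∪ e) := by
  obtain ⟨a, ha⟩ := Finset.card_eq_one.1 h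
  have : ({a} : Finset ι).powerset.erase ∅ = {{a}} := by
    ext J; simp [Finset.subset_singleton_iff]; grind
  rw [sum_starBoundary hK, ha, this]
  simp

/-- The missing part of `e` is one of `{a}`, `{b}`, `{a, b}`, contributing `1 + 1 + (t - 1) = 1 +
t`. -/
theorem sum_starBoundary_of_card_two {n : ℕ} {K : Finset (Finset ι)} (hK : IsGammaComplex n K)
    {e S : Finset ι} (h : (e \ S).card = 2) :
    ∑ T ∈ starBoundary K e with S ⊆ T, (X - 1 : ℤ[X]) ^ (n - (T.card + 1)) =
      (1 + X) * linkH n K (S ∪ e) := by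
  obtain ⟨a, b, hab, he⟩ := Finset.card_eq_two.1 h
  have : ({a, b} : Finset ι).powerset.erase ∅ = {{a}, {b}, {a, b}} := by
    ext J
    simp only [Finset.mem_erase, Finset.mem_powerset, Finset.mem_insert, Finset.mem_singleton]
    constructor
    · rintro ⟨h0, h1⟩
      by_cases ha : a ∈ J <;> by_cases hb : b ∈ J <;> grind
    · grind
  rw [sum_starBoundary hK, he, this, Finset.sum_insert, Finset.sum_insert]
  · simp [Finset.card_pair hab]
  · simp only [Finset.mem_singleton]
    intro h
    have : a ∈ ({b} : Finset ι) := by rw [h]; simp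
    simp [hab] at this
  · simp only [Finset.mem_insert, Finset.mem_singleton, Finset.singleton_inj, not_or]
    refine ⟨hab, fun h => ?_⟩
    have : b ∈ ({a} : Finset ι) := by rw [h]; simp
    simp [hab.symm] at this

theorem sum_deletion_add (n : ℕ) (K : Finset (Finset ι)) (e S : Finset ι) :
    ∑ T ∈ deletion K e with S ⊆ T, (X - 1 : ℤ[X]) ^ (n - T.card) + linkH n K (S ∪ e) =
      linkH n K S := by
  rw [linkH, linkH, ← Finset.sum_filter_not_add_sum_filter {T ∈ K | S ⊆ T} (fun T => e ⊆ T)]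
  congr 1
  · refine Finset.sum_congr ?_ fun _ _ => rfl
    ext T; simp [deletion]; tauto
  · refine Finset.sum_congr ?_ fun _ _ => rfl
    ext T; simp [Finset.union_subset_iff]; tauto

/-- The stellar subdivision at an edge preserves `γ`-nonnegativity of all links. -/
theorem IsGammaComplex.stellar {n : ℕ} {K : Finset (Finset ι)} (hK : IsGammaComplex n K)
    {e : Finset ι} (he : e.card = 2) :
    IsGammaComplex n (stellar K e) where
  down := by
    intro U hU V hVU
    rw [mem_stellar] at hU ⊢
    have hsome : ∀ S : Finset ι, S ∈ deletion K e → V.eraseNone ⊆ S →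
        V.eraseNone ∈ deletion K e := by
      intro S hS h
      simp only [deletion, Finset.mem_filter] at hS ⊢
      exact ⟨hK.down S hS.1 _ h, fun h' => hS.2 (h'.trans h)⟩
    by_cases hn : none ∈ V
    · right
      have hV : Finset.insertNone V.eraseNone = V := by simp [hn]
      rcases hU with ⟨S, hS, rfl⟩ | ⟨S, hS, rfl⟩
      · simpa using hVU hn
      · rw [← hV, insertNone_subset_insertNone] at hVU
        refine ⟨_, ?_, hV⟩
        simp only [starBoundary, Finset.mem_filter] at hS ⊢
        exact ⟨hK.down S hS.1 _ hVU, fun h' => hS.2.1 (h'.trans hVU),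
          hK.down _ hS.2.2 _ (Finset.union_subset_union_left hVU)⟩
    · left
      have hV : V.eraseNone.map Function.Embedding.some = V := by
        rw [Finset.map_some_eraseNone, Finset.erase_eq_of_notMem hn]
      rcases hU with ⟨S, hS, rfl⟩ | ⟨S, hS, rfl⟩
      · refine ⟨_, hsome S hS ?_, hV⟩
        rwa [← hV, Finset.map_subset_map] at hVU
      · refine ⟨_, hsome S ?_ ?_, hV⟩
        · simp only [starBoundary, deletion, Finset.mem_filter] at hS ⊢
          exact ⟨hS.1, hS.2.1⟩
        · rwa [← hV, map_some_subset_insertNone] at hVU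
  empty_mem := by
    rw [mem_stellar]
    left
    refine ⟨∅, ?_, by simp⟩
    simp only [deletion, Finset.mem_filter]
    refine ⟨hK.empty_mem, fun h => ?_⟩
    have := Finset.card_le_card h
    simp [he] at this
  pure := by
    -- A facet `T ⊇ e` is destroyed; trading a vertex of `e` outside `S` for the new vertex gives a
    -- facet of the same size above `S`.
    have aux : ∀ S T : Finset ι, ¬ e ⊆ S → S ⊆ T → T ∈ K → e ⊆ T → T.card = n →
        ∃ T' ∈ starBoundary K e, S ⊆ T' ∧ (Finset.insertNone T').card = n := by
      intro S T heS hST hT heT hn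
      obtain ⟨a, hae, haS⟩ := Finset.not_subset.1 heS
      refine ⟨T.erase a, ?_, ?_, ?_⟩
      · simp only [starBoundary, Finset.mem_filter]
        refine ⟨hK.down T hT _ (Finset.erase_subset _ _), fun h => ?_, ?_⟩
        · simpa using h hae
        · have : T.erase a ∪ e = T := by grind
          rwa [this]
      · exact Finset.subset_erase.2 ⟨hST, haS⟩
      · rw [Finset.card_insertNone, Finset.card_erase_add_one (heT hae), hn]
    intro U hU
    simp only [mem_stellar] at hU ⊢
    rcases hU with ⟨S, hS, rfl⟩ | ⟨S, hS, rfl⟩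
    · simp only [deletion, Finset.mem_filter] at hS
      obtain ⟨T, hT, hST, hn⟩ := hK.pure S hS.1
      by_cases heT : e ⊆ T
      · obtain ⟨T', hT', hST', hn'⟩ := aux S T hS.2 hST hT heT hn
        exact ⟨_, Or.inr ⟨T', hT', rfl⟩, map_some_subset_insertNone.2 hST', hn'⟩
      · refine ⟨_, Or.inl ⟨T, ?_, rfl⟩, Finset.map_subset_map.2 hST, by simpa using hn⟩
        simp only [deletion, Finset.mem_filter]
        exact ⟨hT, heT⟩
    · simp only [starBoundary, Finset.mem_filter] at hS
      obtain ⟨T, hT, hST, hn⟩ := hK.pure _ hS.2.2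
      obtain ⟨T', hT', hST', hn'⟩ := aux S T hS.2.1 (Finset.subset_union_left.trans hST) hT
        (Finset.subset_union_right.trans hST) hn
      exact ⟨_, Or.inr ⟨T', hT', rfl⟩, insertNone_subset_insertNone.2 hST', hn'⟩
  linkH_mem := by
    have hcard : ∀ S : Finset ι, ¬ e ⊆ S → (e \ S).card = 1 ∨ (e \ S).card = 2 := by
      intro S hS
      have h1 : (e \ S).card ≤ 2 := he ▸ Finset.card_le_card Finset.sdiff_subset
      have h2 : 0 < (e \ S).card := by rwa [Finset.card_pos, Finset.sdiff_nonempty]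
      omega
    have hunion : ∀ S : Finset ι, (S ∪ e).card = S.card + (e \ S).card := by
      intro S
      rw [← Finset.union_sdiff_self_eq_union, Finset.card_union_of_disjoint
        Finset.disjoint_sdiff]
    intro U hU
    rw [sum_stellar]
    rcases mem_stellar.1 hU with ⟨S, hS, rfl⟩ | ⟨S, hS, rfl⟩
    · simp only [deletion, Finset.mem_filter] at hS
      simp only [Finset.map_subset_map, map_some_subset_insertNone, Finset.card_map]
      by_cases hSe : S ∪ e ∈ K
      · have hle := hK.card_le hSe
        rw [hunion] at hle
        rcases hcard S hS.2 with h | h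
        · rw [sum_starBoundary_of_card_one hK h, sum_deletion_add]
          exact hK.linkH_mem S hS.1
        · have h3 := hK.linkH_mem _ hSe
          rw [hunion, h] at h3
          have h4 := X_mul_mem_gammaCone h3
          rw [show n - (S.card + 2) + 2 = n - S.card by omega] at h4
          -- Of the `(1 + t) · h(lk(S ∪ e))` coming from the cone, the summand `1` restores the
          -- deleted faces and `t` is the gain.
          rw [sum_starBoundary_of_card_two hK h, add_mul, one_mul, ← add_assoc,
            sum_deletion_add]
          exact add_mem (hK.linkH_mem S hS.1) h4
      · have h0 : linkH n K (S ∪ e) = 0 := by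
          rw [linkH, Finset.filter_false_of_mem, Finset.sum_empty]
          exact fun T hT h => hSe (hK.down T hT _ h)
        have h1 := sum_deletion_add n K e S
        rw [sum_starBoundary hK, h0, mul_zero]
        rw [h0] at h1
        rw [h1]
        exact hK.linkH_mem S hS.1
    · simp only [starBoundary, Finset.mem_filter] at hS
      simp only [not_insertNone_subset_map_some, insertNone_subset_insertNone,
        Finset.filter_false, Finset.sum_empty, zero_add, Finset.card_insertNone]
      have h3 := hK.linkH_mem _ hS.2.2
      have hle := hK.card_le hS.2.2
      rw [hunion] at hle h3
      rcases hcard S hS.2.1 with h | h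
      · rw [sum_starBoundary_of_card_one hK h]
        rwa [h] at h3
      · rw [sum_starBoundary_of_card_two hK h]
        rw [h] at h3
        have h4 := one_add_X_mul_mem_gammaCone h3
        rwa [show n - (S.card + 2) + 1 = n - (S.card + 1) by omega] at h4

end Complex

/-! ### The cross-polytope. -/

/-- The boundary complex of the `n`-dimensional cross-polytope; the vertex `(i, b)` corresponds to
the facet `xᵢ = b` of the cube. -/
def crossPolytope (n : ℕ) : Finset (Finset (Fin n × Bool)) :=
  {S | ∀ i b b', (i, b) ∈ S → (i, b') ∈ S → b = b'}

theorem mem_crossPolytope {n : ℕ} {S : Finset (Fin n × Bool)} :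
    S ∈ crossPolytope n ↔ ∀ i b b', (i, b) ∈ S → (i, b') ∈ S → b = b' := by
  simp [crossPolytope]

/-- The graph of a partial function. -/
def partialGraph {n : ℕ} (f : Fin n → Option Bool) : Finset (Fin n × Bool) :=
  {p | f p.1 = some p.2}

theorem mem_partialGraph {n : ℕ} {f : Fin n → Option Bool} {i : Fin n} {b : Bool} :
    (i, b) ∈ partialGraph f ↔ f i = some b := by
  simp [partialGraph]

theorem partialGraph_mem {n : ℕ} (f : Fin n → Option Bool) :
    partialGraph f ∈ crossPolytope n := by
  rw [mem_crossPolytope]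
  intro i b b' h h'
  rw [mem_partialGraph] at h h'
  simpa [h] using h'

theorem partialGraph_injective (n : ℕ) :
    Function.Injective (partialGraph : (Fin n → Option Bool) → _) := by
  intro f g h
  funext i
  refine Option.ext fun b => ?_
  rw [← mem_partialGraph, h, mem_partialGraph]

theorem exists_partialGraph_eq {n : ℕ} {S : Finset (Fin n × Bool)} (hS : S ∈ crossPolytope n) :
    ∃ f, partialGraph f = S := by
  rw [mem_crossPolytope] at hS
  refine ⟨fun i => if (i, true) ∈ S then some true else if (i, false) ∈ S then some false
    else none, ?_⟩
  ext ⟨i, b⟩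
  rw [mem_partialGraph]
  have := hS i true false
  by_cases h1 : (i, true) ∈ S <;> by_cases h2 : (i, false) ∈ S <;> cases b <;> simp_all

theorem crossPolytope_eq_image (n : ℕ) :
    crossPolytope n = Finset.univ.image partialGraph := by
  ext S
  simp only [Finset.mem_image, Finset.mem_univ, true_and]
  exact ⟨exists_partialGraph_eq, fun ⟨f, hf⟩ => hf ▸ partialGraph_mem f⟩

theorem card_partialGraph {n : ℕ} (f : Fin n → Option Bool) :
    (partialGraph f).card + (Finset.univ.filter fun i => f i = none).card = n := by
  have h1 : (partialGraph f).card = (Finset.univ.filter fun i => ¬ f i = none).card := by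
    refine Finset.card_bij (fun p _ => p.1) ?_ ?_ ?_
    · rintro ⟨i, b⟩ h
      rw [mem_partialGraph] at h
      simp [h]
    · rintro ⟨i, b⟩ h ⟨j, b'⟩ h' hij
      rw [mem_partialGraph] at h h'
      obtain rfl : i = j := hij
      simpa [h] using h'
    · intro i hi
      obtain ⟨b, hb⟩ := Option.ne_none_iff_exists'.1 (Finset.mem_filter.1 hi).2
      exact ⟨(i, b), mem_partialGraph.2 hb, rfl⟩
  rw [h1, add_comm, Finset.card_filter_add_card_filter_not, Finset.card_fin]

/-- Faces are partial functions to `Bool`, so the sum factors over coordinates: a coordinate left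
free by `g` gives `(t - 1) + 1 + 1`, a fixed one gives `1`. -/
theorem linkH_crossPolytope {n : ℕ} (g : Fin n → Option Bool) :
    linkH n (crossPolytope n) (partialGraph g) = (1 + X) ^ (n - (partialGraph g).card) := by
  let w : Fin n → Option Bool → ℤ[X] := fun i o =>
    if g i = none ∨ g i = o then (if o = none then X - 1 else 1) else 0
  have hsub : ∀ f : Fin n → Option Bool,
      partialGraph g ⊆ partialGraph f ↔ ∀ i, g i = none ∨ g i = f i := by
    intro f
    constructor
    · intro h i
      rcases hg : g i with _ | b
      · simp
      · right
        exact (mem_partialGraph.1 (h (mem_partialGraph.2 hg))).symm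
    · rintro h ⟨i, b⟩ hi
      rw [mem_partialGraph] at hi ⊢
      rcases h i with h | h
      · simp [h] at hi
      · rw [← h, hi]
  have hprod : ∀ f : Fin n → Option Bool,
      (if partialGraph g ⊆ partialGraph f then
        (X - 1 : ℤ[X]) ^ (n - (partialGraph f).card) else 0) = ∏ i, w i (f i) := by
    intro f
    by_cases h : partialGraph g ⊆ partialGraph f
    · have hc := card_partialGraph f
      rw [if_pos h, show n - (partialGraph f).card =
        (Finset.univ.filter fun i => f i = none).card by omega, ← Finset.prod_const,
        Finset.prod_filter]
      refine Finset.prod_congr rfl fun i _ => ?_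
      simp only [w]
      rw [if_pos ((hsub f).1 h i)]
    · rw [if_neg h]
      rw [hsub] at h
      push Not at h
      obtain ⟨i, hi⟩ := h
      refine (Finset.prod_eq_zero (Finset.mem_univ i) ?_).symm
      simp only [w]
      rw [if_neg (by tauto)]
  have hw : ∀ i, ∑ o, w i o = if g i = none then 1 + X else 1 := by
    intro i
    simp only [w, Fintype.sum_option, Fintype.sum_bool]
    rcases g i with _ | _ | _ <;> simp
    ring
  rw [linkH, Finset.sum_filter, crossPolytope_eq_image,
    Finset.sum_image fun _ _ _ _ h => partialGraph_injective n h, Finset.sum_congr rfl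
    fun f _ => hprod f, ← Fintype.prod_sum, Finset.prod_congr rfl fun i _ => hw i,
    ← Finset.prod_filter, Finset.prod_const]
  congr 1
  have := card_partialGraph g
  omega

theorem isGammaComplex_crossPolytope (n : ℕ) : IsGammaComplex n (crossPolytope n) where
  down S hS T hT := by
    rw [mem_crossPolytope] at hS ⊢
    exact fun i b b' h h' => hS i b b' (hT h) (hT h')
  empty_mem := by simp [mem_crossPolytope]
  pure S hS := by
    obtain ⟨f, rfl⟩ := exists_partialGraph_eq hS
    refine ⟨partialGraph fun i => some ((f i).getD true), partialGraph_mem _, ?_, ?_⟩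
    · rintro ⟨i, b⟩ h
      rw [mem_partialGraph] at h ⊢
      simp [h]
    · simpa using card_partialGraph fun i => some ((f i).getD true)
  linkH_mem S hS := by
    obtain ⟨f, rfl⟩ := exists_partialGraph_eq hS
    rw [linkH_crossPolytope]
    exact one_add_X_pow_mem_gammaCone _

/-! ### Minimal faces and relative interiors of convex sets. -/

section Core

variable {E : Type*} [AddCommGroup E] [Module ℝ E] {P F F' : Set E} {x y v : E}

theorem mem_openSegment_extension (x y : E) {δ : ℝ} (hδ : 0 < δ) :
    x ∈ openSegment ℝ y (x + δ • (x - y)) := by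
  refine ⟨δ / (1 + δ), 1 / (1 + δ), by positivity, by positivity, by field_simp; ring, ?_⟩
  match_scalars <;> field_simp <;> ring

theorem add_smul_mem_of_le (hP : Convex ℝ P) (hx : x ∈ P) {δ η : ℝ} (h : x + δ • v ∈ P)
    (h0 : 0 ≤ η) (hle : η ≤ δ) : x + η • v ∈ P := by
  rcases h0.eq_or_lt with rfl | h0
  · simpa using hx
  · have hδ : 0 < δ := h0.trans_le hle
    have := hP.add_smul_mem hx h (t := η / δ) ⟨by positivity, (div_le_one hδ).2 hle⟩
    rwa [smul_smul, div_mul_cancel₀ _ hδ.ne'] at this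

/-- The points `y` of `P` such that the segment from `y` to `x` extends beyond `x` in `P`. If `P` is
convex, this is the smallest face of `P` that contains `x`. -/
def minFace (P : Set E) (x : E) : Set E :=
  {y ∈ P | ∃ δ : ℝ, 0 < δ ∧ x + δ • (x - y) ∈ P}

/-- `x` lies in the algebraic relative interior of `F`. -/
def IsCore (F : Set E) (x : E) : Prop :=
  x ∈ F ∧ ∀ y ∈ F, ∃ δ : ℝ, 0 < δ ∧ x + δ • (x - y) ∈ F

theorem isCore_minFace (hx : x ∈ P) : IsCore (minFace P x) x := by
  refine ⟨⟨hx, 1, one_pos, by simpa using hx⟩, ?_⟩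
  rintro y ⟨hy, δ, hδ, h⟩
  refine ⟨δ, hδ, h, δ⁻¹, by positivity, ?_⟩
  convert hy using 1
  match_scalars <;> field_simp <;> ring

theorem isExtreme_minFace (hP : Convex ℝ P) (x : E) : IsExtreme ℝ P (minFace P x) where
  subset := fun _ h => h.1
  left_mem_of_mem_openSegment := by
    rintro p hp q hq z ⟨-, δ, hδ, h⟩ ⟨a, b, ha, hb, hab, rfl⟩
    refine ⟨hp, δ * a / (1 + δ * b), by positivity, ?_⟩
    -- The weights make `q` cancel, leaving a point on the ray from `p` through the given point.
    have := hP h hq (a := 1 / (1 + δ * b)) (b := δ * b / (1 + δ * b)) (by positivity)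
      (by positivity) (by field_simp)
    convert this using 1
    obtain rfl : a = 1 - b := by linarith
    match_scalars <;> field_simp <;> ring

theorem convex_minFace (hP : Convex ℝ P) (hx : x ∈ P) : Convex ℝ (minFace P x) := by
  rintro y ⟨hy, δ, hδ, h⟩ z ⟨hz, η, hη, h'⟩ a b ha hb hab
  refine ⟨hP hy hz ha hb hab, min δ η, lt_min hδ hη, ?_⟩
  have h1 := add_smul_mem_of_le hP hx h (lt_min hδ hη).le (min_le_left _ _)
  have h2 := add_smul_mem_of_le hP hx h' (lt_min hδ hη).le (min_le_right _ _)
  convert hP h1 h2 ha hb hab using 1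
  obtain rfl : a = 1 - b := by linarith
  match_scalars <;> ring

theorem IsCore.subset_of_isExtreme (hx : IsCore F x) (hFP : F ⊆ P) (hF' : IsExtreme ℝ P F')
    (hxF' : x ∈ F') : F ⊆ F' := by
  intro y hy
  obtain ⟨δ, hδ, h⟩ := hx.2 y hy
  exact hF'.left_mem_of_mem_openSegment (hFP hy) (hFP h) hxF' (mem_openSegment_extension x y hδ)

/-- The minimal face of the new point contains the core point `x`, hence is all of `F`. -/
theorem IsCore.add_smul_sub (hF : Convex ℝ F) (hx : IsCore F x) (hv : v ∈ F) {s : ℝ}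
    (hs : 0 < s) (hs1 : s ≤ 1) : IsCore F (v + s • (x - v)) := by
  have hmem : v + s • (x - v) ∈ F := hF.add_smul_sub_mem hv hx.1 ⟨hs.le, hs1⟩
  have hxm : x ∈ minFace F (v + s • (x - v)) := by
    refine ⟨hx.1, ?_⟩
    rcases hs1.eq_or_lt with rfl | hs1
    · exact ⟨1, one_pos, by simpa using hx.1⟩
    · have : 0 < 1 - s := by linarith
      refine ⟨s / (1 - s), by positivity, ?_⟩
      convert hv using 1
      match_scalars <;> field_simp <;> ring
  have heq : minFace F (v + s • (x - v)) = F :=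
    (isExtreme_minFace hF _).subset.antisymm
      (hx.subset_of_isExtreme subset_rfl (isExtreme_minFace hF _) hxm)
  have := isCore_minFace hmem
  rwa [heq] at this

/-- The directions along which one can move both ways from `x` form a subspace by convexity, and it
contains every `y - x` with `y ∈ F`. -/
theorem IsCore.exists_smul_mem (hF : Convex ℝ F) (hx : IsCore F x) {d : E}
    (hd : d ∈ vectorSpan ℝ F) : ∃ s : ℝ, 0 < s ∧ x + s • d ∈ F ∧ x - s • d ∈ F := by
  rw [vectorSpan_eq_span_vsub_set_right ℝ hx.1] at hd
  induction hd using Submodule.span_induction with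
  | mem d hd =>
    obtain ⟨y, hy, rfl⟩ := hd
    obtain ⟨δ, hδ, h⟩ := hx.2 y hy
    have h1 : x + (1 : ℝ) • (y - x) ∈ F := by simpa using hy
    refine ⟨min 1 δ, by positivity,
      add_smul_mem_of_le hF hx.1 h1 (by positivity) (min_le_left _ _), ?_⟩
    have := add_smul_mem_of_le hF hx.1 h (η := min 1 δ) (by positivity) (min_le_right _ _)
    convert this using 1
    simp only [vsub_eq_sub]
    module
  | zero => exact ⟨1, one_pos, by simpa using hx.1, by simpa using hx.1⟩
  | add d e _ _ hd he =>
    obtain ⟨s, hs, h1, h2⟩ := hd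
    obtain ⟨t, ht, h3, h4⟩ := he
    have hst : t / (s + t) + s / (s + t) = 1 := by field_simp; ring
    refine ⟨s * t / (s + t), by positivity, ?_, ?_⟩
    · convert hF h1 h3 (by positivity) (by positivity) hst using 1
      match_scalars <;> field_simp <;> ring
    · convert hF h2 h4 (by positivity) (by positivity) hst using 1
      match_scalars <;> field_simp <;> ring
  | smul a d _ hd =>
    obtain ⟨s, hs, h1, h2⟩ := hd
    rcases lt_trichotomy a 0 with ha | rfl | ha
    · have ha' := ha.ne
      refine ⟨s / -a, div_pos hs (neg_pos.2 ha), ?_, ?_⟩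
      · convert h2 using 1
        match_scalars <;> field_simp
      · convert h1 using 1
        match_scalars <;> field_simp
    · exact ⟨1, one_pos, by simpa using hx.1, by simpa using hx.1⟩
    · refine ⟨s / a, by positivity, ?_, ?_⟩
      · convert h1 using 1
        match_scalars <;> field_simp
      · convert h2 using 1
        match_scalars <;> field_simp

end Core

/-! ### Exposed faces of polytopes. -/

section Exposed

variable {E : Type*} [NormedAddCommGroup E] [NormedSpace ℝ E] {P F : Set E}

theorem exists_extremePoint_forall_le (hF : IsCompact F) (hne : F.Nonempty)
    (l : StrongDual ℝ E) : ∃ v ∈ F.extremePoints ℝ, ∀ y ∈ F, l y ≤ l v := by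
  obtain ⟨z, hz, hmax⟩ := hF.exists_isMaxOn hne l.continuous.continuousOn
  have h : IsExposed ℝ F {y ∈ F | ∀ w ∈ F, l w ≤ l y} := fun _ => ⟨l, rfl⟩
  obtain ⟨v, hv⟩ := (h.isCompact hF).extremePoints_nonempty ⟨z, hz, hmax⟩
  exact ⟨v, h.isExtreme.extremePoints_subset_extremePoints hv, hv.1.2⟩

variable [FiniteDimensional ℝ E]

theorem exists_isCore (hF : Convex ℝ F) (hne : F.Nonempty) : ∃ x, IsCore F x := by
  obtain ⟨x, hx⟩ := hne.intrinsicInterior hF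
  have hxF := intrinsicInterior_subset hx
  obtain ⟨x', hx', rfl⟩ := mem_intrinsicInterior.1 hx
  refine ⟨_, hxF, fun y hy => ?_⟩
  let g : ℝ → affineSpan ℝ F := fun δ =>
    ⟨AffineMap.lineMap (x' : E) y (-δ), AffineMap.lineMap_mem _ x'.2 (subset_affineSpan ℝ F hy)⟩
  have hg : Continuous g := by
    refine Continuous.subtype_mk ?_ _
    simp only [AffineMap.lineMap_apply]
    fun_prop
  have hg0 : g 0 = x' := by ext; simp [g]
  have hnhds : ((↑) ⁻¹' F : Set (affineSpan ℝ F)) ∈ nhds (g 0) := by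
    rw [hg0]; exact mem_interior_iff_mem_nhds.1 hx'
  have h1 := (hg.tendsto 0).eventually hnhds
  obtain ⟨δ, hδ, hpos⟩ := ((h1.filter_mono nhdsWithin_le_nhds).and
    (self_mem_nhdsWithin (s := Set.Ioi (0 : ℝ)))).exists
  refine ⟨δ, hpos, ?_⟩
  have h2 : (g δ : E) ∈ F := hδ
  convert h2 using 1
  simp only [g, AffineMap.lineMap_apply, vsub_eq_sub, vadd_eq_add]
  module

/-- Every minimal face of a polytope is exposed. -/
theorem isExposed_minFace_convexHull (V : Finset E) {x : E} (hx : x ∈ convexHull ℝ (V : Set E)) :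
    IsExposed ℝ (convexHull ℝ (V : Set E)) (minFace (convexHull ℝ (V : Set E)) x) := by
  set P := convexHull ℝ (V : Set E) with hPdef
  set F := minFace P x with hFdef
  have hP : Convex ℝ P := convex_convexHull ℝ _
  have hF : Convex ℝ F := convex_minFace hP hx
  have hFe : IsExtreme ℝ P F := isExtreme_minFace hP x
  have hcore : IsCore F x := isCore_minFace hx
  let W : Set E := V \ F
  have hWfin : W.Finite := V.finite_toSet.subset Set.sdiff_subset
  have hW : convexHull ℝ W ⊆ P \ F :=
    convexHull_min (Set.sdiff_subset_sdiff_left (subset_convexHull ℝ _)) (hFe.convex_sdiff hP)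
  let D : Submodule ℝ E := vectorSpan ℝ F
  -- A point `x + d` of `P` with `d ∈ D` already lies in `F`, because `x - s • d` stays in `F` for
  -- some `s > 0`. So the hull of the remaining points misses the whole affine hull of `F`.
  have hdisj : Disjoint (convexHull ℝ W) ((fun d => x + d) '' (D : Set E)) := by
    rw [Set.disjoint_left]
    rintro _ hz ⟨d, hd, rfl⟩
    obtain ⟨s, hs, -, h⟩ := hcore.exists_smul_mem hF hd
    refine (hW hz).2 ⟨(hW hz).1, s, hs, ?_⟩
    convert h.1 using 1
    module
  obtain ⟨f, u, v, hfu, huv, hfv⟩ := geometric_hahn_banach_compact_closed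
    (convex_convexHull ℝ W) (hWfin.isCompact_convexHull ℝ) (D.convex.translate x)
    ((Homeomorph.addLeft x).isClosedMap _ D.closed_of_finiteDimensional) hdisj
  have hD : ∀ d ∈ D, f d = 0 := by
    intro d hd
    by_contra hne
    -- This multiple of `d` would give `f` exactly the value `v`, its strict lower bound.
    have h := hfv _ ⟨((v - f x) / f d) • d, D.smul_mem _ hd, rfl⟩
    simp [hne] at h
  have hfF : ∀ y ∈ F, f y = f x := by
    intro y hy
    have h := hD _ (vsub_mem_vectorSpan ℝ hy hcore.1)
    rw [vsub_eq_sub, map_sub] at h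
    linarith
  have hux : u < f x := by
    have h := hfv _ ⟨0, D.zero_mem, rfl⟩
    simp only [add_zero] at h
    linarith
  have hPle : ∀ y ∈ P, f y ≤ f x := by
    have hsub : P ⊆ {y | f y ≤ f x} := by
      refine convexHull_min (fun y hy => ?_) (convex_halfSpace_le f.isLinear _)
      by_cases hyF : y ∈ F
      · exact (hfF y hyF).le
      · exact ((hfu y (subset_convexHull ℝ _ ⟨hy, hyF⟩)).trans hux).le
    exact hsub
  intro _
  refine ⟨f, Set.Subset.antisymm (fun y hy => ⟨hy.1, fun z hz => ?_⟩) ?_⟩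
  · rw [hfF y hy]
    exact hPle z hz
  · have hB : IsExposed ℝ P {y ∈ P | ∀ z ∈ P, f z ≤ f y} := fun _ => ⟨f, rfl⟩
    have hPc : IsCompact P := V.finite_toSet.isCompact_convexHull ℝ
    -- By Krein–Milman it suffices to treat extreme points of the maximal face; these are in `V`,
    -- and points of `V` outside `F` have `f < u < f x`.
    rw [← closure_convexHull_extremePoints (hB.isCompact hPc) (hB.convex hP)]
    have hfin : ((V : Set E) ∩ F).Finite := V.finite_toSet.subset Set.inter_subset_left
    refine (closure_mono (convexHull_mono (t := (V : Set E) ∩ F) fun y hy => ?_)).trans ?_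
    · have hyV : y ∈ (V : Set E) :=
        extremePoints_convexHull_subset (hB.isExtreme.extremePoints_subset_extremePoints hy)
      refine ⟨hyV, ?_⟩
      by_contra hyF
      have h1 := hfu y (subset_convexHull ℝ _ ⟨hyV, hyF⟩)
      have h2 := hy.1.2 x hx
      linarith
    · rw [(hfin.isClosed_convexHull ℝ).closure_eq]
      exact convexHull_min Set.inter_subset_right hF

end Exposed

variable {n : ℕ}

/-! ### Faces of a half-space section. -/

section Cut

variable {P F F' : Set (Fin n → ℝ)} {l : StrongDual ℝ (Fin n → ℝ)} {b : ℝ}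

/-- The functional exposing `F` vanishes on the direction space of `F` but not on that of `F'`. -/
theorem dim_lt_of_ssubset (hF : IsFace P F) (hF' : F' ⊆ P) (h : F ⊂ F') : dim F < dim F' := by
  obtain ⟨m, hm⟩ := hF.2 hF.1
  obtain ⟨z, hz⟩ := hF.1
  obtain ⟨y, hy, hyF⟩ := Set.exists_of_ssubset h
  have hzP := hz
  rw [hm] at hzP
  have hlt : m y < m z := by
    refine lt_of_le_of_ne (hzP.2 y (hF' hy)) fun heq => hyF ?_
    rw [hm]
    exact ⟨hF' hy, fun w hw => heq ▸ hzP.2 w hw⟩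
  refine Submodule.finrank_lt_finrank_of_lt (lt_of_le_of_ne (vectorSpan_mono ℝ h.subset) ?_)
  intro heq
  have hker : vectorSpan ℝ F ≤ LinearMap.ker (m : (Fin n → ℝ) →ₗ[ℝ] ℝ) := by
    rw [vectorSpan_eq_span_vsub_set_right ℝ hz, Submodule.span_le]
    rintro _ ⟨w, hw, rfl⟩
    have h1 := hzP.2 w (hF.2.subset hw)
    rw [hm] at hw
    have h2 := hw.2 z hzP.1
    simp only [SetLike.mem_coe, LinearMap.mem_ker, vsub_eq_sub, map_sub]
    exact sub_eq_zero.2 (le_antisymm h1 h2)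
  have hyz := vsub_mem_vectorSpan ℝ hy (h.subset hz)
  rw [← heq] at hyz
  have := hker hyz
  simp only [LinearMap.mem_ker, vsub_eq_sub, map_sub] at this
  exact hlt.ne (sub_eq_zero.1 this)

theorem isFace_self (hP : P.Nonempty) : IsFace P P := ⟨hP, IsExposed.refl P⟩

theorem isFace_sep_le (hF : IsFace P F) (hne : {x ∈ F | l x ≤ b}.Nonempty) :
    IsFace {x ∈ P | l x ≤ b} {x ∈ F | l x ≤ b} := by
  refine ⟨hne, fun _ => ?_⟩
  obtain ⟨m, hm⟩ := hF.2 hF.1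
  obtain ⟨z, hz, hzb⟩ := hne
  rw [hm] at hz
  refine ⟨m, Set.Subset.antisymm ?_ ?_⟩
  · rintro x ⟨hx, hxb⟩
    rw [hm] at hx
    exact ⟨⟨hx.1, hxb⟩, fun y hy => hx.2 y hy.1⟩
  · rintro x ⟨⟨hx, hxb⟩, hmax⟩
    refine ⟨?_, hxb⟩
    rw [hm]
    exact ⟨hx, fun y hy => (hz.2 y hy).trans (hmax z ⟨hz.1, hzb⟩)⟩

theorem isFace_sep_eq (hF : IsFace P F) (hne : {x ∈ F | l x = b}.Nonempty) :
    IsFace {x ∈ P | l x ≤ b} {x ∈ F | l x = b} := by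
  have h1 : IsFace {x ∈ P | l x ≤ b} {x ∈ F | l x ≤ b} :=
    isFace_sep_le hF (hne.mono fun x hx => ⟨hx.1, hx.2.le⟩)
  have h2 : IsExposed ℝ {x ∈ P | l x ≤ b} {x ∈ P | l x = b} := by
    rintro -
    obtain ⟨z, hz, hzb⟩ := hne
    refine ⟨l, Set.Subset.antisymm ?_ ?_⟩
    · rintro x ⟨hx, hxb⟩
      exact ⟨⟨hx, hxb.le⟩, fun y hy => hy.2.trans hxb.ge⟩
    · rintro x ⟨⟨hx, hxb⟩, hmax⟩
      exact ⟨hx, le_antisymm hxb (hzb ▸ hmax z ⟨hF.2.subset hz, hzb.le⟩)⟩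
  have heq : {x ∈ F | l x = b} = {x ∈ F | l x ≤ b} ∩ {x ∈ P | l x = b} := by
    ext x
    constructor
    · rintro ⟨hx, hxb⟩
      exact ⟨⟨hx, hxb.le⟩, hF.2.subset hx, hxb⟩
    · rintro ⟨⟨hx, -⟩, -, hxb⟩
      exact ⟨hx, hxb⟩
  exact ⟨hne, heq ▸ h1.2.inter h2⟩

theorem exists_isCore_lt (hF : Convex ℝ F) {v : Fin n → ℝ} (hv : v ∈ F) (hvb : l v < b) :
    ∃ x, IsCore F x ∧ l x < b := by
  obtain ⟨x, hx⟩ := exists_isCore hF ⟨v, hv⟩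
  rcases lt_or_ge (l x) b with h | h
  · exact ⟨x, hx, h⟩
  · have hpos : 0 < l x - l v := by linarith
    -- With this `s` the new point has `l` halfway between `l v` and `b`.
    refine ⟨_, hx.add_smul_sub hF hv (s := (b - l v) / (2 * (l x - l v)))
      (div_pos (by linarith) (by linarith)) ((div_le_one (by linarith)).2 (by linarith)), ?_⟩
    have : (b - l v) / (2 * (l x - l v)) * (l x - l v) = (b - l v) / 2 := by field_simp
    rw [map_add, map_smul, map_sub, smul_eq_mul, this]
    linarith

theorem exists_isCore_eq (hF : Convex ℝ F) {v w : Fin n → ℝ} (hv : v ∈ F) (hvb : l v < b)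
    (hw : w ∈ F) (hwb : b < l w) : ∃ x, IsCore F x ∧ l x = b := by
  obtain ⟨x, hx, hxb⟩ := exists_isCore_lt hF hv hvb
  have hpos : 0 < l w - l x := by linarith
  refine ⟨_, hx.add_smul_sub hF hw (s := (l w - b) / (l w - l x))
    (div_pos (by linarith) hpos) ((div_le_one hpos).2 (by linarith)), ?_⟩
  rw [map_add, map_smul, map_sub, smul_eq_mul]
  field_simp
  ring

/-- The faces of a convex set cut by a half-space, in terms of the minimal faces of the set. -/
theorem eq_sep_minFace_of_isFace (hP : Convex ℝ P) (hF : IsFace {x ∈ P | l x ≤ b} F) :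
    ∃ x ∈ P, (l x < b ∧ F = {y ∈ minFace P x | l y ≤ b}) ∨
      (l x = b ∧ F = {y ∈ minFace P x | l y = b}) := by
  have hQ : Convex ℝ {x ∈ P | l x ≤ b} := hP.inter (convex_halfSpace_le l.isLinear b)
  obtain ⟨x, hx⟩ := exists_isCore (hF.2.convex hQ) hF.1
  have hsub := hF.2.subset
  have hxQ := hsub hx.1
  have hmin : F ⊆ minFace P x := by
    intro y hy
    obtain ⟨δ, hδ, h⟩ := hx.2 y hy
    exact ⟨(hsub hy).1, δ, hδ, (hsub h).1⟩
  refine ⟨x, hxQ.1, hxQ.2.lt_or_eq.imp ?_ ?_⟩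
  · intro hxb
    refine ⟨hxb, Set.Subset.antisymm (fun y hy => ⟨hmin hy, (hsub hy).2⟩) ?_⟩
    rintro y ⟨⟨hy, δ, hδ, h⟩, hyb⟩
    -- As `l x < b` strictly, a short enough extension beyond `x` stays in the half-space.
    obtain ⟨η, hη, hηδ, hηb⟩ : ∃ η : ℝ, 0 < η ∧ η ≤ δ ∧ η * (l x - l y) ≤ b - l x := by
      refine ⟨min δ ((b - l x) / (|l x - l y| + 1)), lt_min hδ (div_pos (by linarith)
        (by positivity)), min_le_left _ _, ?_⟩
      calc min δ ((b - l x) / (|l x - l y| + 1)) * (l x - l y)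
          ≤ (b - l x) / (|l x - l y| + 1) * (|l x - l y| + 1) := by
            refine mul_le_mul_of_nonneg (min_le_right _ _) ?_ ?_ (by positivity)
            · linarith [le_abs_self (l x - l y)]
            · exact (lt_min hδ (div_pos (by linarith) (by positivity))).le
        _ = b - l x := div_mul_cancel₀ _ (by positivity)
    refine hF.2.isExtreme.left_mem_of_mem_openSegment ⟨hy, hyb⟩
      (y := x + η • (x - y)) ⟨add_smul_mem_of_le hP hxQ.1 h hη.le hηδ, ?_⟩ hx.1
      (mem_openSegment_extension x y hη)
    rw [map_add, map_smul, map_sub, smul_eq_mul]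
    linarith
  · intro hxb
    refine ⟨hxb, Set.Subset.antisymm (fun y hy => ⟨hmin hy, ?_⟩) ?_⟩
    · obtain ⟨δ, hδ, h⟩ := hx.2 y hy
      have h1 := (hsub hy).2
      have h2 := (hsub h).2
      rw [map_add, map_smul, map_sub, smul_eq_mul, hxb] at h2
      have h3 : δ * (b - l y) ≤ 0 := by linarith
      have h4 := nonpos_of_mul_nonpos_right h3 hδ
      linarith
    · rintro y ⟨⟨hy, δ, hδ, h⟩, hyb⟩
      refine hF.2.isExtreme.left_mem_of_mem_openSegment ⟨hy, hyb.le⟩ (y := x + δ • (x - y))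
        ⟨h, ?_⟩ hx.1 (mem_openSegment_extension x y hδ)
      rw [map_add, map_smul, map_sub, smul_eq_mul, hyb, hxb]
      simp

theorem vectorSpan_sep_le (hP : Convex ℝ P) {v : Fin n → ℝ} (hv : v ∈ P) (hvb : l v < b) :
    vectorSpan ℝ {x ∈ P | l x ≤ b} = vectorSpan ℝ P := by
  refine le_antisymm (vectorSpan_mono ℝ fun x hx => hx.1) ?_
  rw [vectorSpan_eq_span_vsub_set_right ℝ hv, Submodule.span_le]
  rintro _ ⟨y, hy, rfl⟩
  obtain ⟨s, hs, hs1, hsb⟩ : ∃ s : ℝ, 0 < s ∧ s ≤ 1 ∧ s * (l y - l v) ≤ b - l v := by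
    rcases le_or_gt (l y) b with h | h
    · exact ⟨1, one_pos, le_rfl, by linarith⟩
    · exact ⟨(b - l v) / (l y - l v), div_pos (by linarith) (by linarith),
        (div_le_one (by linarith)).2 (by linarith), (div_mul_cancel₀ _ (by linarith)).le⟩
  have h1 : v + s • (y - v) ∈ {x ∈ P | l x ≤ b} := by
    refine ⟨hP.add_smul_sub_mem hv hy ⟨hs.le, hs1⟩, ?_⟩
    rw [map_add, map_smul, map_sub, smul_eq_mul]
    linarith
  have h2 := vsub_mem_vectorSpan ℝ h1 (⟨hv, hvb.le⟩ : v ∈ {x ∈ P | l x ≤ b})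
  have h3 := Submodule.smul_mem _ s⁻¹ h2
  simpa [smul_smul, inv_mul_cancel₀ hs.ne'] using h3

end Cut

/-! ### Simplicial complexes dual to polytopes. -/

section Dual

variable {ι : Type*}

/-- `φ` identifies the simplicial complex `K`, with reversed inclusion, with the poset of nonempty
faces of the `n`-dimensional convex set `P`. -/
structure IsDualComplex (P : Set (Fin n → ℝ)) (K : Finset (Finset ι))
    (φ : Finset ι → Set (Fin n → ℝ)) : Prop where
  isFace : ∀ S ∈ K, IsFace P (φ S)
  exists_eq : ∀ F, IsFace P F → ∃ S ∈ K, φ S = F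
  subset_iff : ∀ S ∈ K, ∀ T ∈ K, φ T ⊆ φ S ↔ S ⊆ T
  dim_eq : dim P = n

variable {P Q : Set (Fin n → ℝ)} {K : Finset (Finset ι)} {φ : Finset ι → Set (Fin n → ℝ)}

theorem IsDualComplex.injOn (h : IsDualComplex P K φ) : Set.InjOn φ K := by
  intro S hS T hT hST
  exact ((h.subset_iff S hS T hT).1 hST.ge).antisymm ((h.subset_iff T hT S hS).1 hST.le)

variable [DecidableEq ι]

theorem IsDualComplex.apply_empty (h : IsDualComplex P K φ) (hK : IsGammaComplex n K) :
    φ ∅ = P := by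
  have h0 := h.isFace ∅ hK.empty_mem
  obtain ⟨S, hS, hSP⟩ := h.exists_eq P (isFace_self (h0.1.mono h0.2.subset))
  refine h0.2.subset.antisymm ?_
  rw [← hSP, h.subset_iff _ hK.empty_mem _ hS]
  exact Finset.empty_subset S

theorem IsDualComplex.dim_add_card_le (h : IsDualComplex P K φ) (hK : IsGammaComplex n K)
    {S T : Finset ι} (hT : T ∈ K) (hST : S ⊆ T) :
    dim (φ T) + T.card ≤ dim (φ S) + S.card := by
  have key : ∀ A : Finset ι, S ∪ A ∈ K →
      dim (φ (S ∪ A)) + (S ∪ A).card ≤ dim (φ S) + S.card := by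
    intro A
    induction A using Finset.induction_on with
    | empty => simp
    | insert a A ha ih =>
      intro hA
      rw [Finset.union_insert] at hA ⊢
      have hA' : S ∪ A ∈ K := hK.down _ hA _ (Finset.subset_insert _ _)
      by_cases haS : a ∈ S ∪ A
      · rw [Finset.insert_eq_of_mem haS]
        exact ih hA'
      · have hlt : dim (φ (insert a (S ∪ A))) < dim (φ (S ∪ A)) := by
          refine dim_lt_of_ssubset (h.isFace _ hA) (h.isFace _ hA').2.subset ⟨?_, ?_⟩
          · rw [h.subset_iff _ hA' _ hA]
            exact Finset.subset_insert _ _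
          · rw [h.subset_iff _ hA _ hA']
            exact fun hsub => haS (hsub (Finset.mem_insert_self _ _))
        have := ih hA'
        rw [Finset.card_insert_of_notMem haS]
        omega
  have := key T (by rwa [Finset.union_eq_right.2 hST])
  rwa [Finset.union_eq_right.2 hST] at this

/-- Each added vertex lowers the dimension by at least one; a chain from `∅`, of dimension `n`,
through `S` to a facet of size `n` leaves no slack. Thus the face order alone determines dimensions,
as combinatorial equivalence requires. -/
theorem IsDualComplex.dim_add_card (h : IsDualComplex P K φ) (hK : IsGammaComplex n K)
    {S : Finset ι} (hS : S ∈ K) : dim (φ S) + S.card = n := by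
  have h1 := h.dim_add_card_le hK hS (Finset.empty_subset S)
  rw [h.apply_empty hK, h.dim_eq, Finset.card_empty] at h1
  obtain ⟨T, hT, hST, hn⟩ := hK.pure S hS
  have h2 := h.dim_add_card_le hK hT hST
  omega

theorem IsDualComplex.fVector_eq (h : IsDualComplex P K φ) (hK : IsGammaComplex n K) (i : ℕ) :
    fVector P i = (K.filter fun S => n - S.card = i).card := by
  have : {F | IsFace P F ∧ dim F = i} = φ '' (K.filter fun S => n - S.card = i) := by
    ext F
    simp only [Set.mem_ofPred_eq, Finset.coe_filter, Set.mem_image]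
    constructor
    · rintro ⟨hF, hd⟩
      obtain ⟨S, hS, rfl⟩ := h.exists_eq F hF
      have := h.dim_add_card hK hS
      exact ⟨S, ⟨hS, by omega⟩, rfl⟩
    · rintro ⟨S, ⟨hS, hd⟩, rfl⟩
      have := h.dim_add_card hK hS
      exact ⟨h.isFace S hS, by omega⟩
  rw [fVector, this, (h.injOn.mono fun S hS => (Finset.mem_filter.1 hS).1).ncard_image, Set.ncard_coe_finset]

theorem IsDualComplex.hPoly_eq (h : IsDualComplex P K φ) (hK : IsGammaComplex n K) :
    hPoly P = linkH n K ∅ := by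
  rw [linkH, Finset.filter_true_of_mem (fun S _ => Finset.empty_subset S), hPoly,
    ← Finset.sum_fiberwise_of_maps_to (g := fun S : Finset ι => n - S.card)
      (t := Finset.range (n + 1)) fun S _ => Finset.mem_range.2 (by omega)]
  refine Finset.sum_congr rfl fun i _ => ?_
  rw [h.fVector_eq hK, Finset.sum_congr rfl (g := fun _ => (X - 1 : ℤ[X]) ^ i), Finset.sum_const]
  · simp
  · intro S hS
    rw [(Finset.mem_filter.1 hS).2]

open Classical in
theorem IsDualComplex.of_combEquiv (h : IsDualComplex P K φ) (hQ : IsPolytope Q)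
    (hPQ : CombEquiv P Q) : ∃ ψ, IsDualComplex Q K ψ := by
  obtain ⟨e⟩ := hPQ
  have hval : ∀ S (hS : S ∈ K), (if hS : S ∈ K then (e ⟨φ S, h.isFace S hS⟩ : Set (Fin n → ℝ))
      else ∅) = e ⟨φ S, h.isFace S hS⟩ := fun S hS => dif_pos hS
  refine ⟨fun S => if hS : S ∈ K then e ⟨φ S, h.isFace S hS⟩ else ∅, ?_, ?_, ?_, hQ.dim_eq⟩
  · intro S hS
    rw [hval S hS]
    exact (e _).2
  · intro F hF
    obtain ⟨S, hS, hSF⟩ := h.exists_eq _ (e.symm ⟨F, hF⟩).2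
    refine ⟨S, hS, ?_⟩
    rw [hval S hS]
    simp [hSF]
  · intro S hS T hT
    rw [hval S hS, hval T hT, ← h.subset_iff S hS T hT]
    exact e.le_iff_le (x := ⟨φ T, h.isFace T hT⟩) (y := ⟨φ S, h.isFace S hS⟩)

end Dual

/-! ### The cube is dual to the cross-polytope. -/

section Cube

theorem dim_cube (n : ℕ) : dim (cube n) = n := by
  have : vectorSpan ℝ (cube n) = ⊤ := by
    rw [eq_top_iff, ← (Pi.basisFun ℝ (Fin n)).span_eq, Submodule.span_le]
    rintro _ ⟨i, rfl⟩
    have h0 : (0 : Fin n → ℝ) ∈ cube n := ⟨le_rfl, zero_le_one⟩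
    have h1 : Pi.single i (1 : ℝ) ∈ cube n := by
      refine ⟨Pi.single_nonneg.2 zero_le_one, fun j => ?_⟩
      by_cases hj : j = i
      · subst hj; simp
      · simp [hj]
    simpa using vsub_mem_vectorSpan ℝ h1 h0
  rw [dim, this, finrank_top, Module.finrank_fin_fun]

/-- The face of the cube on the facets `xᵢ = b`, for `(i, b)` in `S`. -/
def cubeFace (S : Finset (Fin n × Bool)) : Set (Fin n → ℝ) :=
  {x ∈ cube n | ∀ p ∈ S, x p.1 = if p.2 then 1 else 0}

/-- A point in the relative interior of `cubeFace S`. -/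
noncomputable def cubeFaceCenter (S : Finset (Fin n × Bool)) : Fin n → ℝ :=
  fun i => if (i, true) ∈ S then 1 else if (i, false) ∈ S then 0 else 1 / 2

theorem cubeFaceCenter_mem {S : Finset (Fin n × Bool)} (hS : S ∈ crossPolytope n) :
    cubeFaceCenter S ∈ cubeFace S := by
  rw [mem_crossPolytope] at hS
  refine ⟨⟨fun i => ?_, fun i => ?_⟩, ?_⟩
  · simp only [cubeFaceCenter, Pi.zero_apply]; split_ifs <;> norm_num
  · simp only [cubeFaceCenter, Pi.one_apply]; split_ifs <;> norm_num
  · rintro ⟨i, b⟩ h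
    have := hS i true false
    cases b <;> simp_all [cubeFaceCenter]

theorem isFace_cubeFace {S : Finset (Fin n × Bool)} (hS : S ∈ crossPolytope n) :
    IsFace (cube n) (cubeFace S) := by
  have hc := cubeFaceCenter_mem hS
  refine ⟨⟨_, hc⟩, fun _ => ?_⟩
  let f : StrongDual ℝ (Fin n → ℝ) :=
    ∑ p ∈ S, (if p.2 then (1 : ℝ) else -1) • ContinuousLinearMap.proj p.1
  have hf : ∀ x, f x = ∑ p ∈ S, (if p.2 then (1 : ℝ) else -1) * x p.1 := by
    intro x
    simp only [f, sum_apply, smul_apply, smul_eq_mul,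
      ContinuousLinearMap.proj_apply]
  have hle : ∀ x ∈ cube n, ∀ p ∈ S,
      (if p.2 then (1 : ℝ) else -1) * x p.1 ≤ if p.2 then 1 else 0 := by
    rintro x hx ⟨i, b⟩ -
    have h0 := hx.1 i
    have h1 := hx.2 i
    simp only [Pi.zero_apply, Pi.one_apply] at h0 h1
    cases b <;> simp <;> linarith
  have heq : ∀ x ∈ cubeFace S, f x = ∑ p ∈ S, if p.2 then (1 : ℝ) else 0 := by
    intro x hx
    rw [hf]
    refine Finset.sum_congr rfl fun p hp => ?_
    rw [hx.2 p hp]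
    split_ifs <;> simp
  refine ⟨f, Set.Subset.antisymm (fun x hx => ⟨hx.1, fun y hy => ?_⟩) ?_⟩
  · rw [heq x hx, hf]
    exact Finset.sum_le_sum (hle y hy)
  · rintro x ⟨hx, hmax⟩
    refine ⟨hx, fun p hp => ?_⟩
    have h1 := hmax _ hc.1
    rw [heq _ hc, hf] at h1
    have h2 := (Finset.sum_eq_sum_iff_of_le (hle x hx)).1
      (le_antisymm (Finset.sum_le_sum (hle x hx)) h1) p hp
    split_ifs at h2 ⊢ <;> linarith

theorem exists_cubeFace_eq {F : Set (Fin n → ℝ)} (hF : IsFace (cube n) F) :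
    ∃ S ∈ crossPolytope n, cubeFace S = F := by
  obtain ⟨f, hf⟩ := hF.2 hF.1
  let m : Fin n → ℝ := fun i => f (Pi.single i 1)
  have hfm : ∀ x, f x = ∑ i, x i * m i := by
    intro x
    conv_lhs => rw [pi_eq_sum_univ' x]
    rw [map_sum]
    refine Finset.sum_congr rfl fun i _ => ?_
    rw [map_smul, smul_eq_mul]
  -- A linear function on the cube is maximized coordinatewise, so the signs of its coefficients
  -- determine the face.
  let S : Finset (Fin n × Bool) :=
    Finset.univ.filter fun p => if p.2 then 0 < m p.1 else m p.1 < 0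
  have hSpos : ∀ i, (i, true) ∈ S ↔ 0 < m i := fun i => by simp [S]
  have hSneg : ∀ i, (i, false) ∈ S ↔ m i < 0 := fun i => by simp [S]
  have hS : S ∈ crossPolytope n := by
    rw [mem_crossPolytope]
    rintro i (_ | _) (_ | _) h h' <;> simp_all
    · linarith
    · linarith
  have hle : ∀ x ∈ cube n, ∀ z ∈ cubeFace S, ∀ i, x i * m i ≤ z i * m i := by
    intro x hx z hz i
    have h0 := hx.1 i
    have h1 := hx.2 i
    simp only [Pi.zero_apply, Pi.one_apply] at h0 h1
    rcases lt_trichotomy (m i) 0 with h | h | h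
    · have hzi : z i = 0 := by simpa using hz.2 _ ((hSneg i).2 h)
      rw [hzi, zero_mul]
      exact mul_nonpos_of_nonneg_of_nonpos h0 h.le
    · simp [h]
    · have hzi : z i = 1 := by simpa using hz.2 _ ((hSpos i).2 h)
      rw [hzi]
      exact mul_le_mul_of_nonneg_right h1 h.le
  have hc := cubeFaceCenter_mem hS
  refine ⟨S, hS, ?_⟩
  rw [hf]
  refine Set.Subset.antisymm (fun x hx => ⟨hx.1, fun y hy => ?_⟩) ?_
  · rw [hfm, hfm]
    exact Finset.sum_le_sum fun i _ => hle y hy x hx i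
  · rintro x ⟨hx, hmax⟩
    have h1 := hmax _ hc.1
    rw [hfm, hfm] at h1
    have h2 := (Finset.sum_eq_sum_iff_of_le fun i _ => hle x hx _ hc i).1
      (le_antisymm (Finset.sum_le_sum fun i _ => hle x hx _ hc i) h1)
    refine ⟨hx, fun p hp => ?_⟩
    have hm : m p.1 ≠ 0 := by
      obtain ⟨i, b⟩ := p
      cases b
      · exact ((hSneg i).1 hp).ne
      · exact ((hSpos i).1 hp).ne'
    rw [← hc.2 p hp]
    exact mul_right_cancel₀ hm (h2 p.1 (Finset.mem_univ _))

theorem isDualComplex_cube (n : ℕ) : IsDualComplex (cube n) (crossPolytope n) cubeFace where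
  isFace _ hS := isFace_cubeFace hS
  exists_eq _ hF := exists_cubeFace_eq hF
  subset_iff S _ T hT := by
    constructor
    · rintro h ⟨i, b⟩ hp
      have h1 := (h (cubeFaceCenter_mem hT)).2 _ hp
      simp only [cubeFaceCenter] at h1
      by_contra hn
      cases b <;> split_ifs at h1 <;> norm_num at h1 <;> contradiction
    · intro h x hx
      exact ⟨hx.1, fun p hp => hx.2 p (h hp)⟩
  dim_eq := dim_cube n

end Cube

/-! ### Shaving is dual to stellar subdivision. -/

section Shaving

variable {ι : Type*} [DecidableEq ι] {P Q : Set (Fin n → ℝ)} {K : Finset (Finset ι)}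
  {φ : Finset ι → Set (Fin n → ℝ)}

/-- Shaving the face dual to `e` is dual to the stellar subdivision at `e`. -/
theorem IsDualComplex.of_isShaving (h : IsDualComplex P K φ) (hK : IsGammaComplex n K)
    {e : Finset ι} (he : e ∈ K) (hQ : IsShaving P (φ e) Q) (hne : e.Nonempty) :
    ∃ ψ, IsDualComplex Q (stellar K e) ψ := by
  classical
  obtain ⟨l', c, ε, hε, hlc, hG, hv, rfl⟩ := hQ.exists_cut
  obtain ⟨V, hV⟩ := hQ.simple.eq_convexHull
  have hP : Convex ℝ P := hV ▸ convex_convexHull ℝ _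
  have hPc : IsCompact P := hV ▸ V.finite_toSet.isCompact_convexHull ℝ
  obtain ⟨l, hl⟩ : ∃ l : StrongDual ℝ (Fin n → ℝ), ∀ x, l x = l' x :=
    ⟨LinearMap.toContinuousLinearMap l', fun _ => rfl⟩
  simp only [← hl] at *
  set b := c - ε with hb
  have hbc : b < c := by linarith
  have hexp : ∀ x ∈ P, IsFace P (minFace P x) := by
    intro x hx
    refine ⟨⟨x, (isCore_minFace hx).1⟩, ?_⟩
    subst hV
    exact isExposed_minFace_convexHull V hx
  have hext : ∀ F, IsFace P F → ∀ v ∈ F.extremePoints ℝ, v ∉ φ e → l v < b := fun F hF v hvF =>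
    hv v (hF.2.isExtreme.extremePoints_subset_extremePoints hvF)
  -- If a vertex minimizing `l` on `φ S` were in the shaved face, `l` would equal `c` on `φ S`,
  -- forcing `φ S ⊆ φ e`.
  have hlow : ∀ S ∈ K, ¬ e ⊆ S → ∃ v ∈ φ S, l v < b := by
    intro S hS heS
    obtain ⟨v, hvS, hmin⟩ := exists_extremePoint_forall_le ((h.isFace S hS).2.isCompact hPc)
      (h.isFace S hS).1 (-l)
    refine ⟨v, hvS.1, hext _ (h.isFace S hS) v hvS fun hvG => heS ?_⟩
    rw [← h.subset_iff e he S hS]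
    intro y hy
    rw [← hG] at hvG ⊢
    have hyP := (h.isFace S hS).2.subset hy
    refine ⟨hyP, le_antisymm (hlc y hyP) ?_⟩
    have := hmin y hy
    simp only [neg_apply, neg_le_neg_iff] at this
    rw [← hvG.2]
    exact this
  have hhigh : ∀ S ∈ K, S ∪ e ∈ K → ∃ w ∈ φ S, b < l w := by
    intro S hS hSe
    obtain ⟨w, hw⟩ := (h.isFace _ hSe).1
    have hwG := (h.subset_iff e he _ hSe).2 Finset.subset_union_right hw
    rw [← hG] at hwG
    exact ⟨w, (h.subset_iff S hS _ hSe).2 Finset.subset_union_left hw, hwG.2 ▸ hbc⟩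
  have hconv : ∀ S ∈ K, Convex ℝ (φ S) := fun S hS => (h.isFace S hS).2.convex hP
  have hcorelt : ∀ S ∈ deletion K e, ∃ x, IsCore (φ S) x ∧ l x < b := by
    intro S hS
    simp only [deletion, Finset.mem_filter] at hS
    obtain ⟨v, hvS, hvb⟩ := hlow S hS.1 hS.2
    exact exists_isCore_lt (hconv S hS.1) hvS hvb
  have hcoreeq : ∀ S ∈ starBoundary K e, ∃ x, IsCore (φ S) x ∧ l x = b := by
    intro S hS
    simp only [starBoundary, Finset.mem_filter] at hS
    obtain ⟨v, hvS, hvb⟩ := hlow S hS.1 hS.2.1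
    obtain ⟨w, hwS, hwb⟩ := hhigh S hS.1 hS.2.2
    exact exists_isCore_eq (hconv S hS.1) hvS hvb hwS hwb
  -- Core points at the right height let inclusions of cut faces be read off from the uncut ones.
  have hsub : ∀ S ∈ K, ∀ T ∈ K, ∀ x, IsCore (φ T) x → x ∈ φ S → S ⊆ T := by
    intro S hS T hT x hx hxS
    rw [← h.subset_iff S hS T hT]
    exact hx.subset_of_isExtreme (h.isFace T hT).2.subset (h.isFace S hS).2.isExtreme hxS
  have hmemK : ∀ S ∈ deletion K e, S ∈ K := fun S hS => (Finset.mem_filter.1 hS).1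
  have hmemK' : ∀ S ∈ starBoundary K e, S ∈ K := fun S hS => (Finset.mem_filter.1 hS).1
  let ψ : Finset (Option ι) → Set (Fin n → ℝ) := fun U =>
    if none ∈ U then {x ∈ φ U.eraseNone | l x = b} else {x ∈ φ U.eraseNone | l x ≤ b}
  have hψ0 : ∀ S : Finset ι, ψ (S.map Function.Embedding.some) = {x ∈ φ S | l x ≤ b} := by
    intro S; simp [ψ]
  have hψ1 : ∀ S : Finset ι, ψ (Finset.insertNone S) = {x ∈ φ S | l x = b} := by
    intro S; simp [ψ]
  refine ⟨ψ, ?_, ?_, ?_, ?_⟩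
  · intro U hU
    rcases mem_stellar.1 hU with ⟨S, hS, rfl⟩ | ⟨S, hS, rfl⟩
    · obtain ⟨x, hx, hxb⟩ := hcorelt S hS
      rw [hψ0]
      exact isFace_sep_le (h.isFace S (hmemK S hS)) ⟨x, hx.1, hxb.le⟩
    · obtain ⟨x, hx, hxb⟩ := hcoreeq S hS
      rw [hψ1]
      exact isFace_sep_eq (h.isFace S (hmemK' S hS)) ⟨x, hx.1, hxb⟩
  · intro F hF
    obtain ⟨x, hx, hcase⟩ := eq_sep_minFace_of_isFace hP hF
    obtain ⟨S, hS, hSx⟩ := h.exists_eq _ (hexp x hx)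
    have hxS : x ∈ φ S := hSx ▸ (isCore_minFace hx).1
    have heS : l x ≤ b → ¬ e ⊆ S := by
      intro hxb heS
      have hxG := (h.subset_iff e he S hS).2 heS hxS
      rw [← hG] at hxG
      have := hxG.2
      linarith
    rcases hcase with ⟨hxb, rfl⟩ | ⟨hxb, rfl⟩
    · refine ⟨_, mem_stellar.2 (Or.inl ⟨S, ?_, rfl⟩), ?_⟩
      · exact Finset.mem_filter.2 ⟨hS, heS hxb.le⟩
      · rw [hψ0, hSx]
    · refine ⟨_, mem_stellar.2 (Or.inr ⟨S, ?_, rfl⟩), ?_⟩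
      · refine Finset.mem_filter.2 ⟨hS, heS hxb.le, ?_⟩
        -- A vertex maximizing `l` on `φ S` has `l v ≥ b`, so it lies in the shaved face; thus `φ S
        -- ∩ φ e` is a nonempty face and `S ∪ e ∈ K`.
        obtain ⟨v, hvS, hmax⟩ := exists_extremePoint_forall_le
          ((h.isFace S hS).2.isCompact hPc) (h.isFace S hS).1 l
        have hvG : v ∈ φ e := by
          by_contra hvG
          have h1 := hext _ (h.isFace S hS) v hvS hvG
          have h2 := hmax x hxS
          linarith
        obtain ⟨T, hT, hTeq⟩ := h.exists_eq (φ S ∩ φ e)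
          ⟨⟨v, hvS.1, hvG⟩, (h.isFace S hS).2.inter (h.isFace e he).2⟩
        refine hK.down T hT _ (Finset.union_subset ?_ ?_)
        · exact (h.subset_iff S hS T hT).1 (hTeq ▸ Set.inter_subset_left)
        · exact (h.subset_iff e he T hT).1 (hTeq ▸ Set.inter_subset_right)
      · rw [hψ1, hSx]
  · intro U hU W hW
    rcases mem_stellar.1 hU with ⟨S, hS, rfl⟩ | ⟨S, hS, rfl⟩ <;>
      rcases mem_stellar.1 hW with ⟨T, hT, rfl⟩ | ⟨T, hT, rfl⟩
    · rw [hψ0, hψ0, Finset.map_subset_map]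
      constructor
      · intro hle
        obtain ⟨x, hx, hxb⟩ := hcorelt T hT
        exact hsub S (hmemK S hS) T (hmemK T hT) x hx (hle ⟨hx.1, hxb.le⟩).1
      · intro hST x hx
        exact ⟨(h.subset_iff S (hmemK S hS) T (hmemK T hT)).2 hST hx.1, hx.2⟩
    · rw [hψ0, hψ1, map_some_subset_insertNone]
      constructor
      · intro hle
        obtain ⟨x, hx, hxb⟩ := hcoreeq T hT
        exact hsub S (hmemK S hS) T (hmemK' T hT) x hx (hle ⟨hx.1, hxb⟩).1
      · intro hST x hx
        exact ⟨(h.subset_iff S (hmemK S hS) T (hmemK' T hT)).2 hST hx.1, hx.2.le⟩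
    · refine iff_of_false (fun hle => ?_) not_insertNone_subset_map_some
      rw [hψ0, hψ1] at hle
      obtain ⟨x, hx, hxb⟩ := hcorelt T hT
      exact hxb.ne (hle ⟨hx.1, hxb.le⟩).2
    · rw [hψ1, hψ1, insertNone_subset_insertNone]
      constructor
      · intro hle
        obtain ⟨x, hx, hxb⟩ := hcoreeq T hT
        exact hsub S (hmemK' S hS) T (hmemK' T hT) x hx (hle ⟨hx.1, hxb⟩).1
      · intro hST x hx
        exact ⟨(h.subset_iff S (hmemK' S hS) T (hmemK' T hT)).2 hST hx.1, hx.2⟩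
  · obtain ⟨v, hvP, hvb⟩ := hlow ∅ hK.empty_mem
      fun h0 => hne.ne_empty (Finset.subset_empty.1 h0)
    rw [dim, vectorSpan_sep_le hP ((h.isFace _ hK.empty_mem).2.subset hvP) hvb]
    exact h.dim_eq

end Shaving

/-! ### Induction over the shaving process and conclusion. -/

theorem IsShavedCube.exists_isDualComplex {P : Set (Fin n → ℝ)} (hP : IsShavedCube P) :
    ∃ (ι : Type) (_ : DecidableEq ι) (K : Finset (Finset ι)) (φ : Finset ι → Set (Fin n → ℝ)),
      IsGammaComplex n K ∧ IsDualComplex P K φ := by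
  induction hP with
  | cube =>
    exact ⟨_, inferInstance, _, _, isGammaComplex_crossPolytope n, isDualComplex_cube n⟩
  | shave _ hdim hQ ih =>
    obtain ⟨ι, _, K, φ, hK, hφ⟩ := ih
    obtain ⟨e, he, rfl⟩ := hφ.exists_eq _ hQ.isFace
    have hcard : e.card = 2 := by
      have := hφ.dim_add_card hK he
      omega
    obtain ⟨ψ, hψ⟩ := hφ.of_isShaving hK he hQ (Finset.card_pos.1 (by omega))
    exact ⟨_, inferInstance, _, ψ, hK.stellar hcard, hψ⟩
  | equiv _ hQ hPQ ih =>
    obtain ⟨ι, _, K, φ, hK, hφ⟩ := ih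
    obtain ⟨ψ, hψ⟩ := hφ.of_combEquiv hQ hPQ
    exact ⟨ι, inferInstance, K, ψ, hK, hψ⟩

end ShavedCubes

theorem mainTheorem4 (n : ℕ) (P : Set (Fin n → ℝ)) (hP : ShavedCubes.IsShavedCube P) :
    ∃ γ : Fin (n / 2 + 1) → ℤ,
      ShavedCubes.IsGammaVector P γ ∧
      (∀ γ' : Fin (n / 2 + 1) → ℤ, ShavedCubes.IsGammaVector P γ' → γ' = γ) ∧
      ∀ i, 0 ≤ γ i := by
  obtain ⟨ι, _, K, φ, hK, hφ⟩ := hP.exists_isDualComplex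
  have hmem := hK.linkH_mem ∅ hK.empty_mem
  rw [← hφ.hPoly_eq hK, Finset.card_empty, Nat.sub_zero] at hmem
  obtain ⟨γ, hγ, heq⟩ := ShavedCubes.exists_nonneg_coeff_of_mem_gammaCone hmem
  exact ⟨γ, heq, fun γ' hγ' => ShavedCubes.gamma_expansion_injective (hγ'.symm.trans heq), hγ⟩
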